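/- **Definitions.** Write $\mathbb N=\{0,1,2,\dots\}$ and $\mathbb Z_+=\{1,2,\dots\}$. A CAT(0) space is a geodesic metric space $(X,d)$ such that $d(z,m)^2\le\frac12 d(z,x)^2+\frac12 d(z,y)^2-\frac14 d(x,y)^2$ for all $x,y,z,m\in X$ with $d(x,m)=d(y,m)=\frac12 d(x,y)$. In such a space any two points $x,y$ are joined by a unique geodesic, and for $t\in[0,1]$ we write $(1-t)x\oplus ty$ for the point of it at distance $t\,d(x,y)$ from $x$. A set $C\subseteq X$ is convex if it contains all points $(1-t)x\oplus ty$ with $x,y\in C$, $t\in[0,1]$. For a sequence $(a_n)_{n\ge1}$ of reals: $\gamma:(0,\infty)\to\mathbb Z_+$ is a *rate of convergence* of $(a_n)$ towards $a$ if $|a_n-a|\le\varepsilon$ for all $\varepsilon>0$ and $n\ge\gamma(\varepsilon)$; $\gamma:(0,\infty)\to\mathbb Z_+$ is a *Cauchy modulus* of $(a_n)$ if $a_{\gamma(\varepsilon)+n}-a_{\gamma(\varepsilon)}\le\varepsilon$ for all $\varepsilon>0$ and $n\in\mathbb N$; $\gamma:\mathbb Z_+\to\mathbb Z_+$ is a *rate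 of divergence* of $\sum_{n\ge1}a_n$ if $\sum_{k=1}^{\gamma(n)}a_k\ge n$ for all $n\in\mathbb Z_+$. **Theorem.** Let $X$ be a complete CAT(0) space, $C\subseteq X$ a closed bounded convex subset with diameter $d_C$, and $T:C\to C$ nonexpansive. Let $(\lambda_n)_{n\ge1}$ be a sequence in $[0,1]$ such that (C1) $\lim_{n\to\infty}\lambda_n=0$, (C2) $\sum_{n\ge1}|\lambda_{n+1}-\lambda_n|$ converges, (C3) $\sum_{n\ge1}\lambda_n=\infty$. Let $u,x\in C$ and let $(x_n)$ be the Halpern iteration $$x_0=x,\qquad x_{n+1}=\lambda_{n+1}u\oplus(1-\lambda_{n+1})Tx_n .$$ Then $(x_n)$ is Cauchy. Furthermore, let $\alpha$ be a rate of convergence of $(\lambda_n)$ towards $0$, $\beta$ a Cauchy modulus of $s_n=\sum_{i=1}^n|\lambda_{i+1}-\lambda_i|$, $\theta$ a rate of divergence of $\sum_{n\ge1}\lambda_{n+1}$, and $M\in\mathbb Z_+$ with $M\ge d_C$. Then for all $\varepsilon\in(0,2)$ and all $g:\mathbb N\to\mathbb N$, $$\exists N\le\Sigma(\varepsilon,g,M,\theta,\alpha,\beta)\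 \ \forall m,n\in[N,N+g(N)]\quad d(x_n,x_m)\le\varepsilon,$$ where $$\Sigma(\varepsilon,g,M,\theta,\alpha,\beta)=\theta^+\Big(\Gamma-1+\Big\lceil\ln\Big(\frac{12M^2}{\varepsilon^2}\Big)\Big\rceil\Big)+1,\qquad \theta^+(n)=\max\{\theta(i)\mid 1\le i\le n\},$$ $$\varepsilon_0=\frac{\varepsilon^2}{24(M+1)^2},\qquad \Gamma=\max\Big\{\chi_k^*(\varepsilon^2/12)\ \Big|\ \Big\lceil\frac1{\varepsilon_0}\Big\rceil\le k\le\widetilde{f^*}^{(\lceil M^2/\varepsilon_0^2\rceil)}(0)+\Big\lceil\frac1{\varepsilon_0}\Big\rceil\Big\},$$ the superscript in parentheses denoting iteration, and for $k,n\in\mathbb N$ and the real arguments $\delta>0$ that occur, $$\tilde\Phi(\delta)=\theta\Big(\beta\Big(\frac{\delta}{4M}\Big)+1+\Big\lceil\ln\Big(\frac{2M}{\delta}\Big)\Big\rceil\Big)+1,\qquad \Phi(\delta)=\max\Big\{\tilde\Phi\Big(\frac\delta2\Big),\alpha\Big(\frac{\delta}{4M}\Big)\Big\},$$ $$\tilde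 P_k(\delta)=\Big\lceil\frac{12M^2(k+1)}{\delta}\,\Phi\Big(\frac{\delta}{12M(k+1)}\Big)\Big\rceil,\qquad \chi_k^*(\delta)=\tilde\Phi\Big(\frac{\delta}{4M(\tilde P_k(\delta/2)+1)}\Big)+\tilde P_k(\delta/2),$$ $$\Theta_k(\delta)=\theta\Big(\chi_k^*\Big(\frac\delta3\Big)-1+\Big\lceil\ln\Big(\frac{3M^2}{\delta}\Big)\Big\rceil\Big)+1,\qquad g_{\delta,k}(n)=n+g\Big(n+\chi_k^*\Big(\frac\delta3\Big)\Big),$$ $$\Delta_k^*(\delta,g)=\frac{\delta}{3\,g_{\delta,k}\big(\Theta_k(\delta)-\chi_k^*(\delta/3)\big)},\qquad f(k)=\max\Big\{\Big\lceil\frac{M^2}{\Delta_k^*(\varepsilon^2/4,g)}\Big\rceil,k\Big\}-k,$$ $$f^*(k)=f\Big(k+\Big\lceil\frac1{\varepsilon_0}\Big\rceil\Big)+\Big\lceil\frac1{\varepsilon_0}\Big\rceil,\qquad \widetilde{f^*}(k)=k+f^*(k).$$ In particular the bound does not depend on $T$, $u$, $x$, $C$ or $X$, and depends on $(\lambda_n)$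 only through $\alpha,\beta,\theta$. -/

import Mathlib

noncomputable section

namespace HalpernCAT0

/-! ### Geodesic spaces, CAT(0) spaces and convex combinations -/

/-- `γ`, restricted to `[0, dist x y]`, is a geodesic path from `x` to `y`. -/
def IsGeodesic {X : Type*} [MetricSpace X] (γ : ℝ → X) (x y : X) : Prop :=
  γ 0 = x ∧ γ (dist x y) = y ∧
    ∀ s ∈ Set.Icc 0 (dist x y), ∀ t ∈ Set.Icc 0 (dist x y), dist (γ s) (γ t) = |s - t|

/-- A CAT(0) space: a geodesic metric space that satisfies the CN inequality of Bruhat and Tits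
for every midpoint `m` of every pair `x, y`. -/
class CAT0Space (X : Type*) [MetricSpace X] : Prop where
  exists_geodesic : ∀ x y : X, ∃ γ : ℝ → X, IsGeodesic γ x y
  cn : ∀ x y z m : X, dist x m = (1 / 2) * dist x y → dist y m = (1 / 2) * dist x y →
    dist z m ^ 2 ≤ (1 / 2) * dist z x ^ 2 + (1 / 2) * dist z y ^ 2 - (1 / 4) * dist x y ^ 2

/-- The point `(1 - t) x ⊕ t y`, for `t ∈ [0,1]`: the point at distance `t * dist x y` from `x` on
the geodesic from `x` to `y` (geodesics in CAT(0) spaces are unique). -/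
def comb {X : Type*} [MetricSpace X] [CAT0Space X] (x y : X) (t : ℝ) : X :=
  (CAT0Space.exists_geodesic x y).choose (t * dist x y)

theorem dist_left_comb {X : Type*} [MetricSpace X] [CAT0Space X] (x y : X) {t : ℝ}
    (ht : t ∈ Set.Icc (0 : ℝ) 1) : dist x (comb x y t) = t * dist x y := by
  have hd : 0 ≤ dist x y := dist_nonneg
  obtain ⟨h0, _, h⟩ := (CAT0Space.exists_geodesic x y).choose_spec
  have h2 := h 0 ⟨le_refl _, hd⟩ (t * dist x y)
    ⟨mul_nonneg ht.1 hd, mul_le_of_le_one_left hd ht.2⟩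
  rw [h0, zero_sub, abs_neg, abs_of_nonneg (mul_nonneg ht.1 hd)] at h2
  exact h2

theorem dist_right_comb {X : Type*} [MetricSpace X] [CAT0Space X] (x y : X) {t : ℝ}
    (ht : t ∈ Set.Icc (0 : ℝ) 1) : dist y (comb x y t) = (1 - t) * dist x y := by
  have hd : 0 ≤ dist x y := dist_nonneg
  obtain ⟨_, h1, h⟩ := (CAT0Space.exists_geodesic x y).choose_spec
  have h2 := h (dist x y) ⟨hd, le_refl _⟩ (t * dist x y)
    ⟨mul_nonneg ht.1 hd, mul_le_of_le_one_left hd ht.2⟩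
  have h3 : dist x y - t * dist x y = (1 - t) * dist x y := by ring
  rw [h1, h3, abs_of_nonneg (mul_nonneg (sub_nonneg.2 ht.2) hd)] at h2
  exact h2

/-- Convexity of a subset: it contains the segment `[x, y] = {(1 - t) x ⊕ t y : t ∈ [0,1]}` of any
two of its points. -/
def IsConvex {X : Type*} [MetricSpace X] [CAT0Space X] (C : Set X) : Prop :=
  ∀ x ∈ C, ∀ y ∈ C, ∀ t ∈ Set.Icc (0 : ℝ) 1, comb x y t ∈ C

/-- The Halpern iteration `x₀ = x`, `xₙ₊₁ = λₙ₊₁ u ⊕ (1 - λₙ₊₁) T xₙ`. -/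
def halpern {X : Type*} [MetricSpace X] [CAT0Space X] (T : X → X) (lam : ℕ → ℝ) (u x : X) :
    ℕ → X
  | 0 => x
  | n + 1 => comb u (T (halpern T lam u x n)) (1 - lam (n + 1))

/-! ### Rates

Sequences are indexed by `n ≥ 1` (the value at `0` is never used). A function `(0,∞) → ℤ₊` is a
function `ℝ → ℕ` that is positive on `(0,∞)`, and likewise for `ℤ₊ → ℤ₊`; the values outside the
domain are never used. -/

/-- `γ` is a rate of convergence of `(aₙ)` towards `l`. -/
def IsRateOfConvergence (γ : ℝ → ℕ) (a : ℕ → ℝ) (l : ℝ) : Prop :=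
  ∀ ε : ℝ, 0 < ε → 1 ≤ γ ε ∧ ∀ n : ℕ, γ ε ≤ n → |a n - l| ≤ ε

/-- `γ` is a Cauchy modulus of `(aₙ)`. -/
def IsCauchyModulus (γ : ℝ → ℕ) (a : ℕ → ℝ) : Prop :=
  ∀ ε : ℝ, 0 < ε → 1 ≤ γ ε ∧ ∀ n : ℕ, a (γ ε + n) - a (γ ε) ≤ ε

/-- `γ` is a rate of divergence of the series `∑_{n ≥ 1} aₙ`. -/
def IsRateOfDivergence (γ : ℕ → ℕ) (a : ℕ → ℝ) : Prop :=
  ∀ n : ℕ, 1 ≤ n → 1 ≤ γ n ∧ (n : ℝ) ≤ ∑ k ∈ Finset.Icc 1 (γ n), a k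

/-! ### The bound

In everything below `M ≥ 1`, and for `0 < ε < 2` the logarithms that enter the bound are positive,
so that `⌈·⌉₊` is the usual ceiling. One has `chiStar ≥ 1`; moreover `θ n ≥ n` for a rate of
divergence `θ` of a series with terms in `[0,1]`, so that no natural-number subtraction
truncates. -/

/-- `Φ̃(ε)` -/
def PhiTilde (M : ℕ) (θ : ℕ → ℕ) (β : ℝ → ℕ) (ε : ℝ) : ℕ :=
  θ (β (ε / (4 * (M : ℝ))) + 1 + ⌈Real.log (2 * (M : ℝ) / ε)⌉₊) + 1

/-- `Φ(ε)` -/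
def Phi (M : ℕ) (θ : ℕ → ℕ) (α β : ℝ → ℕ) (ε : ℝ) : ℕ :=
  max (PhiTilde M θ β (ε / 2)) (α (ε / (4 * (M : ℝ))))

/-- `P̃ₖ(ε)` -/
def PTilde (M : ℕ) (θ : ℕ → ℕ) (α β : ℝ → ℕ) (k : ℕ) (ε : ℝ) : ℕ :=
  ⌈12 * (M : ℝ) ^ 2 * ((k : ℝ) + 1) / ε *
    (Phi M θ α β (ε / (12 * (M : ℝ) * ((k : ℝ) + 1))) : ℝ)⌉₊

/-- `χ*ₖ(ε)` -/
def chiStar (M : ℕ) (θ : ℕ → ℕ) (α β : ℝ → ℕ) (k : ℕ) (ε : ℝ) : ℕ :=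
  PhiTilde M θ β (ε / (4 * (M : ℝ) * ((PTilde M θ α β k (ε / 2) : ℝ) + 1))) +
    PTilde M θ α β k (ε / 2)

/-- `Θₖ(ε)` -/
def Theta (M : ℕ) (θ : ℕ → ℕ) (α β : ℝ → ℕ) (k : ℕ) (ε : ℝ) : ℕ :=
  θ (chiStar M θ α β k (ε / 3) - 1 + ⌈Real.log (3 * (M : ℝ) ^ 2 / ε)⌉₊) + 1

/-- `g_{ε,k}(n)` -/
def gShift (g : ℕ → ℕ) (M : ℕ) (θ : ℕ → ℕ) (α β : ℝ → ℕ) (ε : ℝ) (k n : ℕ) : ℕ :=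
  n + g (n + chiStar M θ α β k (ε / 3))

/-- `Δ*ₖ(ε, g)` -/
def DeltaStar (g : ℕ → ℕ) (M : ℕ) (θ : ℕ → ℕ) (α β : ℝ → ℕ) (k : ℕ) (ε : ℝ) : ℝ :=
  ε / (3 * (gShift g M θ α β ε k
    (Theta M θ α β k ε - chiStar M θ α β k (ε / 3)) : ℝ))

/-- `ε₀` -/
def eps0 (ε : ℝ) (M : ℕ) : ℝ := ε ^ 2 / (24 * ((M : ℝ) + 1) ^ 2)

/-- `f(k)` -/
def f (ε : ℝ) (g : ℕ → ℕ) (M : ℕ) (θ : ℕ → ℕ) (α β : ℝ → ℕ) (k : ℕ) : ℕ :=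
  max ⌈(M : ℝ) ^ 2 / DeltaStar g M θ α β k (ε ^ 2 / 4)⌉₊ k - k

/-- `f*(k)` -/
def fStar (ε : ℝ) (g : ℕ → ℕ) (M : ℕ) (θ : ℕ → ℕ) (α β : ℝ → ℕ) (k : ℕ) : ℕ :=
  f ε g M θ α β (k + ⌈1 / eps0 ε M⌉₊) + ⌈1 / eps0 ε M⌉₊

/-- the function `k ↦ k + f*(k)` -/
def fStarTilde (ε : ℝ) (g : ℕ → ℕ) (M : ℕ) (θ : ℕ → ℕ) (α β : ℝ → ℕ) (k : ℕ) : ℕ :=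
  k + fStar ε g M θ α β k

/-- `Γ`: a maximum over a nonempty finite set of indices `k` -/
def Gam (ε : ℝ) (g : ℕ → ℕ) (M : ℕ) (θ : ℕ → ℕ) (α β : ℝ → ℕ) : ℕ :=
  (Finset.Icc ⌈1 / eps0 ε M⌉₊
    ((fStarTilde ε g M θ α β)^[⌈(M : ℝ) ^ 2 / eps0 ε M ^ 2⌉₊] 0 + ⌈1 / eps0 ε M⌉₊)).sup
      (fun k => chiStar M θ α β k (ε ^ 2 / 12))

/-- `θ⁺(n) = max {θ(i) : 1 ≤ i ≤ n}` -/
def thetaPlus (θ : ℕ → ℕ) (n : ℕ) : ℕ := (Finset.Icc 1 n).sup θ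

/-- The rate of metastability `Σ(ε, g, M, θ, α, β)`. -/
def SigmaRate (ε : ℝ) (g : ℕ → ℕ) (M : ℕ) (θ : ℕ → ℕ) (α β : ℝ → ℕ) : ℕ :=
  thetaPlus θ (Gam ε g M θ α β - 1 + ⌈Real.log (12 * (M : ℝ) ^ 2 / ε ^ 2)⌉₊) + 1

end HalpernCAT0

end

namespace HalpernCAT0

/-! ### Geometry of convex combinations -/

section Geometry

variable {X : Type*} [MetricSpace X] [CAT0Space X]

/-! The iterates are compared with the resolvents z_k, the fixed points of the contractions y ↦ t u
⊕ (1 - t) T y with t = 1/(k+1). The numbers d(u, z_k)² increase with k (`resolvent_dist_sq_le`) and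
are bounded by M², so iterating `fStarTilde` from 0 meets an interval [K₀, J] on which they grow by
at most ε₀² (`exists_iterate_sub_le`). Asymptotic regularity makes the x_n almost fixed points,
hence for n beyond a threshold χ depending on K ∈ [K₀, J], d(u, z_K)² is almost at most (1 -
λ_{n+1}) d(u, T x_n)² (`dist_resolvent_sq_sub_le`). By the choice of the interval the same holds for
z_J, with the same χ. Then d(x_n, z_J)² obeys a recursion (`dist_halpern_resolvent_sq_le`) with
contraction factor 1 - λ_{n+1}, a small bracket, and error M²/(J+1). J is large enough that this
error stays small when summed over the window that g demands, and the divergence of ∑ λ_n absorbs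
the initial value. All x_n in the window are thus within ε/2 of z_J. -/

theorem dist_comb_comb (x y : X) {s t : ℝ} (hs : s ∈ Set.Icc (0 : ℝ) 1)
    (ht : t ∈ Set.Icc (0 : ℝ) 1) : dist (comb x y s) (comb x y t) = |s - t| * dist x y := by
  have hd : 0 ≤ dist x y := dist_nonneg
  obtain ⟨_, _, h⟩ := (CAT0Space.exists_geodesic x y).choose_spec
  have h2 := h (s * dist x y) ⟨mul_nonneg hs.1 hd, mul_le_of_le_one_left hd hs.2⟩
    (t * dist x y) ⟨mul_nonneg ht.1 hd, mul_le_of_le_one_left hd ht.2⟩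
  rw [← sub_mul, abs_mul, abs_of_nonneg hd] at h2
  exact h2

theorem comb_zero (x y : X) : comb x y 0 = x := by
  have := dist_left_comb x y (t := 0) (by simp)
  rw [zero_mul] at this
  exact (dist_eq_zero.1 this).symm

theorem comb_one (x y : X) : comb x y 1 = y := by
  have := dist_right_comb x y (t := 1) (by simp)
  rw [sub_self, zero_mul] at this
  exact (dist_eq_zero.1 this).symm

theorem continuousOn_comb (x y : X) : ContinuousOn (comb x y) (Set.Icc (0 : ℝ) 1) := by
  have : LipschitzOnWith ⟨dist x y, dist_nonneg⟩ (comb x y) (Set.Icc (0 : ℝ) 1) := by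
    refine LipschitzOnWith.of_dist_le_mul fun s hs t ht => ?_
    rw [dist_comb_comb x y hs ht, Real.dist_eq, mul_comm]
    rfl
  exact this.continuousOn

/-- A continuous midpoint convex function on `[0,1]` that vanishes at the endpoints is
nonpositive. -/
theorem nonpos_of_midpoint_convex {h : ℝ → ℝ} (hc : ContinuousOn h (Set.Icc (0 : ℝ) 1))
    (h0 : h 0 = 0) (h1 : h 1 = 0)
    (hm : ∀ s ∈ Set.Icc (0 : ℝ) 1, ∀ t ∈ Set.Icc (0 : ℝ) 1,
      h ((s + t) / 2) ≤ (h s + h t) / 2) {t : ℝ} (ht : t ∈ Set.Icc (0 : ℝ) 1) : h t ≤ 0 := by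
  obtain ⟨p, hp, hmax⟩ := isCompact_Icc.exists_isMaxOn (Set.nonempty_Icc.2 zero_le_one) hc
  refine (hmax ht).trans ?_
  -- The maximum point p is the midpoint of its nearer endpoint, where h vanishes, and another point
  -- of [0,1]; hence h p ≤ h p / 2.
  rcases le_total p (1 / 2) with h2 | h2
  · have hq : 2 * p ∈ Set.Icc (0 : ℝ) 1 := ⟨by linarith [hp.1], by linarith⟩
    have e := hm 0 (by simp) (2 * p) hq
    rw [show (0 + 2 * p) / 2 = p by ring, h0] at e
    have : h (2 * p) ≤ h p := hmax hq
    linarith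
  · have hq : 2 * p - 1 ∈ Set.Icc (0 : ℝ) 1 := ⟨by linarith, by linarith [hp.2]⟩
    have e := hm (2 * p - 1) hq 1 (by simp)
    rw [show (2 * p - 1 + 1) / 2 = p by ring, h1] at e
    have : h (2 * p - 1) ≤ h p := hmax hq
    linarith

/-- The CN inequality for arbitrary convex combinations. -/
theorem dist_comb_sq_le (z x y : X) {t : ℝ} (ht : t ∈ Set.Icc (0 : ℝ) 1) :
    dist z (comb x y t) ^ 2 ≤
      (1 - t) * dist z x ^ 2 + t * dist z y ^ 2 - t * (1 - t) * dist x y ^ 2 := by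
  set h : ℝ → ℝ := fun s => dist z (comb x y s) ^ 2 -
    ((1 - s) * dist z x ^ 2 + s * dist z y ^ 2 - s * (1 - s) * dist x y ^ 2) with hh
  have key : h t ≤ 0 := by
    refine nonpos_of_midpoint_convex ?_ ?_ ?_ ?_ ht
    · have hcomb := continuousOn_comb x y
      fun_prop
    · simp [hh, comb_zero]
    · simp [hh, comb_one]
    · intro s hs r hr
      have hsr : (s + r) / 2 ∈ Set.Icc (0 : ℝ) 1 :=
        ⟨by linarith [hs.1, hr.1], by linarith [hs.2, hr.2]⟩
      have e0 := dist_comb_comb x y hs hr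
      have e1 : dist (comb x y s) (comb x y ((s + r) / 2)) =
          (1 / 2) * dist (comb x y s) (comb x y r) := by
        rw [dist_comb_comb x y hs hsr, e0, show s - (s + r) / 2 = (1 / 2) * (s - r) by ring,
          abs_mul, abs_of_pos (by norm_num : (0 : ℝ) < 1 / 2)]
        ring
      have e2 : dist (comb x y r) (comb x y ((s + r) / 2)) =
          (1 / 2) * dist (comb x y s) (comb x y r) := by
        rw [dist_comb_comb x y hr hsr, e0, show r - (s + r) / 2 = -((1 / 2) * (s - r)) by ring,
          abs_neg, abs_mul, abs_of_pos (by norm_num : (0 : ℝ) < 1 / 2)]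
        ring
      -- The midpoint defect of s(1 - s) is (s - r)²/4, which matches the last term of the CN
      -- inequality exactly.
      have e := CAT0Space.cn _ _ z _ e1 e2
      rw [e0, mul_pow, sq_abs] at e
      simp only [hh]
      linarith
  simp only [hh] at key
  linarith

/-- Two uses of `dist_comb_sq_le`; all terms involving u cancel and t² d(x, y)² remains. -/
theorem dist_comb_comb_same_left_le (u x y : X) {t : ℝ} (ht : t ∈ Set.Icc (0 : ℝ) 1) :
    dist (comb u x t) (comb u y t) ≤ t * dist x y := by
  refine le_of_sq_le_sq ?_ (mul_nonneg ht.1 dist_nonneg)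
  have h1 := dist_comb_sq_le (comb u x t) u y ht
  have h2 := dist_comb_sq_le y u x ht
  have h3 := dist_left_comb u x ht
  rw [dist_comm u] at h3
  rw [h3, dist_comm (comb u x t) y] at h1
  rw [dist_comm y u, dist_comm y x] at h2
  nlinarith [mul_le_mul_of_nonneg_left h2 ht.1]

end Geometry

/-! ### Real sequences -/

/-- The excess over b is damped by 1 - l ≤ exp(-l) at each step, while the errors at worst add up.
-/
theorem le_of_recursive_inequality {a l e : ℕ → ℝ} {A b : ℝ} (hA : 0 ≤ A)
    (hl : ∀ n, l n ∈ Set.Icc (0 : ℝ) 1) (he : ∀ n, 0 ≤ e n) (h0 : a 0 ≤ A + b)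
    (h : ∀ n, a (n + 1) ≤ (1 - l n) * a n + l n * b + e n) (n : ℕ) :
    a n ≤ A * Real.exp (-∑ i ∈ Finset.range n, l i) + b + ∑ i ∈ Finset.range n, e i := by
  induction n with
  | zero => simpa using h0
  | succ n ih =>
    rw [Finset.sum_range_succ, Finset.sum_range_succ, neg_add, Real.exp_add]
    have hS : 0 ≤ ∑ i ∈ Finset.range n, e i := Finset.sum_nonneg fun i _ => he i
    have hE : 0 ≤ A * Real.exp (-∑ i ∈ Finset.range n, l i) :=
      mul_nonneg hA (Real.exp_pos _).le
    have h1 : 1 - l n ≤ Real.exp (-l n) := by linarith [Real.add_one_le_exp (-l n)]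
    have h2 := mul_le_mul_of_nonneg_left ih (sub_nonneg.2 (hl n).2)
    have h3 := mul_le_mul_of_nonneg_left h1 hE
    have h4 := mul_nonneg (hl n).1 hS
    linarith [h n]

theorem sum_Icc_one_eq_sum_range (a : ℕ → ℝ) (n : ℕ) :
    ∑ k ∈ Finset.Icc 1 n, a k = ∑ k ∈ Finset.range n, a (k + 1) := by
  rw [Finset.range_eq_Ico, Finset.sum_Ico_add' a 0 n 1]
  rfl

section Divergence

variable {lam : ℕ → ℝ} {θ : ℕ → ℕ}

theorem IsRateOfDivergence.le_apply (hlam : ∀ n : ℕ, 1 ≤ n → lam n ∈ Set.Icc (0 : ℝ) 1)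
    (hθ : IsRateOfDivergence θ (fun n : ℕ => lam (n + 1))) {n : ℕ} (hn : 1 ≤ n) : n ≤ θ n := by
  have h : (n : ℝ) ≤ ∑ k ∈ Finset.Icc 1 (θ n), (1 : ℝ) :=
    (hθ n hn).2.trans (Finset.sum_le_sum fun k _ => (hlam (k + 1) (by omega)).2)
  simp only [Finset.sum_const, Nat.card_Icc, nsmul_eq_mul, mul_one] at h
  exact_mod_cast h

/-- The first m terms contribute at most m, so reaching m + r leaves at least r for the tail. -/
theorem IsRateOfDivergence.le_sum (hlam : ∀ n : ℕ, 1 ≤ n → lam n ∈ Set.Icc (0 : ℝ) 1)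
    (hθ : IsRateOfDivergence θ (fun n : ℕ => lam (n + 1))) {m r i : ℕ} (h1 : 1 ≤ m + r)
    (hi : θ (m + r) ≤ m + i) : (r : ℝ) ≤ ∑ j ∈ Finset.range i, lam (m + j + 2) := by
  have h : ((m + r : ℕ) : ℝ) ≤ ∑ k ∈ Finset.range (m + i), lam (k + 2) := by
    refine (hθ _ h1).2.trans ?_
    rw [sum_Icc_one_eq_sum_range]
    exact Finset.sum_le_sum_of_subset_of_nonneg (Finset.range_mono hi)
      fun k _ _ => (hlam (k + 2) (by omega)).1
  rw [Finset.sum_range_add] at h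
  have hm : ∑ k ∈ Finset.range m, lam (k + 2) ≤ ∑ k ∈ Finset.range m, (1 : ℝ) :=
    Finset.sum_le_sum fun k _ => (hlam (k + 2) (by omega)).2
  simp only [Finset.sum_const, Finset.card_range, nsmul_eq_mul, mul_one] at hm
  push_cast at h
  linarith

end Divergence

/-- The quantitative form of the convergence of bounded monotone sequences; monotonicity itself is
not needed for the endpoints `F^[i] 0` and `F^[i + 1] 0`. -/
theorem exists_iterate_sub_le {a : ℕ → ℝ} {B δ : ℝ} (h0 : 0 ≤ a 0)
    (hB : ∀ n, a n ≤ B) {p : ℕ} (hp : 0 < p) (hpB : B ≤ p * δ) (F : ℕ → ℕ) :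
    ∃ i < p, a (F (F^[i] 0)) - a (F^[i] 0) ≤ δ := by
  by_contra! hcon
  have key : ∀ q ≤ p, 0 < q → (q : ℝ) * δ < a (F^[q] 0) := by
    intro q hq hq0
    have := Finset.sum_range_sub (fun i => a (F^[i] 0)) q
    have h2 : ∑ i ∈ Finset.range q, δ <
        ∑ i ∈ Finset.range q, (a (F^[i + 1] 0) - a (F^[i] 0)) := by
      refine Finset.sum_lt_sum_of_nonempty (Finset.nonempty_range_iff.2 hq0.ne') fun i hi => ?_
      rw [Function.iterate_succ_apply']
      exact hcon i (lt_of_lt_of_le (Finset.mem_range.1 hi) hq)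
    rw [this] at h2
    simp only [Finset.sum_const, Finset.card_range, nsmul_eq_mul, Function.iterate_zero,
      id_eq] at h2
    linarith
  linarith [key p le_rfl hp, hB (F^[p] 0)]

/-! ### The Halpern iteration and its resolvents -/

section Halpern

variable {X : Type*} [MetricSpace X] [CAT0Space X] {C : Set X} {T : X → X} {lam : ℕ → ℝ}
  {u x : X} {M : ℕ} {α β : ℝ → ℕ} {θ : ℕ → ℕ}

theorem one_sub_mem_Icc {t : ℝ} (ht : t ∈ Set.Icc (0 : ℝ) 1) : 1 - t ∈ Set.Icc (0 : ℝ) 1 :=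
  ⟨by linarith [ht.2], by linarith [ht.1]⟩

theorem halpern_mem (hConv : IsConvex C) (hTC : Set.MapsTo T C C)
    (hlam : ∀ n : ℕ, 1 ≤ n → lam n ∈ Set.Icc (0 : ℝ) 1) (hu : u ∈ C) (hx : x ∈ C) (n : ℕ) :
    halpern T lam u x n ∈ C := by
  induction n with
  | zero => exact hx
  | succ n ih => exact hConv u hu _ (hTC ih) _ (one_sub_mem_Icc (hlam (n + 1) (by omega)))

/-! ### Asymptotic regularity of the iteration. -/

theorem dist_halpern_succ_le (hConv : IsConvex C) (hTC : Set.MapsTo T C C)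
    (hT : ∀ y ∈ C, ∀ z ∈ C, dist (T y) (T z) ≤ dist y z)
    (hM : ∀ y ∈ C, ∀ z ∈ C, dist y z ≤ M)
    (hlam : ∀ n : ℕ, 1 ≤ n → lam n ∈ Set.Icc (0 : ℝ) 1) (hu : u ∈ C) (hx : x ∈ C) (n : ℕ) :
    dist (halpern T lam u x (n + 2)) (halpern T lam u x (n + 1)) ≤
      (1 - lam (n + 2)) * dist (halpern T lam u x (n + 1)) (halpern T lam u x n) +
        M * |lam (n + 2) - lam (n + 1)| := by
  have hmem := halpern_mem hConv hTC hlam hu hx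
  have l1 := one_sub_mem_Icc (hlam (n + 1) (by omega))
  have l2 := one_sub_mem_Icc (hlam (n + 2) (by omega))
  have h1 := dist_comb_comb_same_left_le u (T (halpern T lam u x (n + 1)))
    (T (halpern T lam u x n)) l2
  have h2 := dist_comb_comb u (T (halpern T lam u x n)) l2 l1
  rw [show 1 - lam (n + 2) - (1 - lam (n + 1)) = -(lam (n + 2) - lam (n + 1)) by ring,
    abs_neg] at h2
  have h3 := mul_le_mul_of_nonneg_left (hM u hu _ (hTC (hmem n)))
    (abs_nonneg (lam (n + 2) - lam (n + 1)))
  have h4 := mul_le_mul_of_nonneg_left (hT _ (hmem (n + 1)) _ (hmem n)) l2.1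
  have h5 := dist_triangle (halpern T lam u x (n + 2))
    (comb u (T (halpern T lam u x n)) (1 - lam (n + 2))) (halpern T lam u x (n + 1))
  change _ ≤ dist (comb u (T (halpern T lam u x (n + 1))) (1 - lam (n + 2))) _ +
    dist _ (comb u (T (halpern T lam u x n)) (1 - lam (n + 1))) at h5
  linarith

/-- `PhiTilde` is a rate of convergence of `d(xₙ₊₁, xₙ)` towards `0`. -/
theorem dist_halpern_succ_le_of_PhiTilde_le (hConv : IsConvex C) (hTC : Set.MapsTo T C C)
    (hT : ∀ y ∈ C, ∀ z ∈ C, dist (T y) (T z) ≤ dist y z)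
    (hM1 : 1 ≤ M) (hM : ∀ y ∈ C, ∀ z ∈ C, dist y z ≤ M)
    (hlam : ∀ n : ℕ, 1 ≤ n → lam n ∈ Set.Icc (0 : ℝ) 1) (hu : u ∈ C) (hx : x ∈ C)
    (hβ : IsCauchyModulus β (fun n : ℕ => ∑ i ∈ Finset.Icc 1 n, |lam (i + 1) - lam i|))
    (hθ : IsRateOfDivergence θ (fun n : ℕ => lam (n + 1))) {δ : ℝ} (hδ : 0 < δ) {n : ℕ}
    (hn : PhiTilde M θ β δ ≤ n) :
    dist (halpern T lam u x (n + 1)) (halpern T lam u x n) ≤ δ := by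
  have hmem := halpern_mem hConv hTC hlam hu hx
  have hMpos : (0 : ℝ) < M := by exact_mod_cast hM1
  unfold PhiTilde at hn
  -- Restarting the recursion at m costs δ/4 for the remaining variation of λ; r makes the damped
  -- initial value at most δ/2.
  set m := β (δ / (4 * (M : ℝ))) with hm
  set r := 1 + ⌈Real.log (2 * (M : ℝ) / δ)⌉₊ with hr
  rw [add_assoc m 1, ← hr] at hn
  have hL : m + r ≤ θ (m + r) := hθ.le_apply hlam (by omega)
  obtain ⟨i, rfl⟩ : ∃ i, n = m + i := ⟨n - m, by omega⟩
  have hsum := hθ.le_sum hlam (m := m) (r := r) (i := i) (by omega) (by omega)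
  have hrec := le_of_recursive_inequality (A := M) (b := 0)
    (a := fun i => dist (halpern T lam u x (m + i + 1)) (halpern T lam u x (m + i)))
    (l := fun i => lam (m + i + 2)) (e := fun i => M * |lam (m + i + 2) - lam (m + i + 1)|)
    hMpos.le (fun j => hlam _ (by omega)) (fun j => by positivity)
    (by simpa using hM _ (hmem _) _ (hmem _))
    (fun j => by
      rw [mul_zero, add_zero]
      exact dist_halpern_succ_le hConv hTC hT hM hlam hu hx (m + j)) i
  have hs : ∑ j ∈ Finset.range i, |lam (m + j + 2) - lam (m + j + 1)| ≤ δ / (4 * M) := by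
    have := (hβ (δ / (4 * M)) (by positivity)).2 i
    simp only [sum_Icc_one_eq_sum_range, ← hm] at this
    rw [Finset.sum_range_add] at this
    simpa [add_assoc] using this
  have hexp : M * Real.exp (-∑ j ∈ Finset.range i, lam (m + j + 2)) ≤ δ / 2 := by
    have h1 : Real.log (2 * M / δ) ≤ ∑ j ∈ Finset.range i, lam (m + j + 2) := by
      refine (Nat.le_ceil _).trans (le_trans ?_ hsum)
      rw [hr]
      push_cast
      linarith
    have h2 : Real.exp (-∑ j ∈ Finset.range i, lam (m + j + 2)) ≤ (2 * M / δ)⁻¹ := by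
      rw [← Real.exp_log (by positivity : (0 : ℝ) < 2 * M / δ), ← Real.exp_neg]
      exact Real.exp_le_exp.2 (by linarith)
    calc M * Real.exp (-∑ j ∈ Finset.range i, lam (m + j + 2)) ≤ M * (2 * M / δ)⁻¹ := by gcongr
      _ = δ / 2 := by field_simp
  rw [← Finset.mul_sum] at hrec
  have hs' : (M : ℝ) * ∑ j ∈ Finset.range i, |lam (m + j + 2) - lam (m + j + 1)| ≤ δ / 4 :=
    calc _ ≤ (M : ℝ) * (δ / (4 * M)) := by gcongr
      _ = δ / 4 := by field_simp
  linarith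

/-- `Phi` is a rate of convergence of `d(xₙ, T xₙ)` towards `0`. -/
theorem dist_halpern_map_le_of_Phi_le (hConv : IsConvex C) (hTC : Set.MapsTo T C C)
    (hT : ∀ y ∈ C, ∀ z ∈ C, dist (T y) (T z) ≤ dist y z)
    (hM1 : 1 ≤ M) (hM : ∀ y ∈ C, ∀ z ∈ C, dist y z ≤ M)
    (hlam : ∀ n : ℕ, 1 ≤ n → lam n ∈ Set.Icc (0 : ℝ) 1) (hu : u ∈ C) (hx : x ∈ C)
    (hα : IsRateOfConvergence α lam 0)
    (hβ : IsCauchyModulus β (fun n : ℕ => ∑ i ∈ Finset.Icc 1 n, |lam (i + 1) - lam i|))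
    (hθ : IsRateOfDivergence θ (fun n : ℕ => lam (n + 1))) {δ : ℝ} (hδ : 0 < δ) {n : ℕ}
    (hn : Phi M θ α β δ ≤ n) :
    lam (n + 1) ≤ δ / (4 * M) ∧
      dist (halpern T lam u x n) (T (halpern T lam u x n)) ≤ δ := by
  have hMpos : (0 : ℝ) < M := by exact_mod_cast hM1
  have hmem := halpern_mem hConv hTC hlam hu hx
  have h1 := dist_halpern_succ_le_of_PhiTilde_le hConv hTC hT hM1 hM hlam hu hx hβ hθ
    (half_pos hδ) ((le_max_left _ _).trans hn)
  have h2 := (hα (δ / (4 * M)) (by positivity)).2 (n + 1)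
    (((le_max_right _ _).trans hn).trans n.le_succ)
  rw [sub_zero] at h2
  have hl := hlam (n + 1) (by omega)
  have h3 : dist (T (halpern T lam u x n)) (halpern T lam u x (n + 1)) =
      (1 - (1 - lam (n + 1))) * dist u (T (halpern T lam u x n)) :=
    dist_right_comb u (T (halpern T lam u x n)) (one_sub_mem_Icc hl)
  have h4 : lam (n + 1) ≤ δ / (4 * M) := (le_abs_self _).trans h2
  refine ⟨h4, ?_⟩
  have h5 : lam (n + 1) * dist u (T (halpern T lam u x n)) ≤ δ / (4 * M) * M :=
    mul_le_mul h4 (hM u hu _ (hTC (hmem n))) dist_nonneg (by positivity)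
  rw [show δ / (4 * M) * M = δ / 4 by field_simp] at h5
  have h6 := dist_triangle_right (halpern T lam u x n) (T (halpern T lam u x n))
    (halpern T lam u x (n + 1))
  rw [dist_comm (halpern T lam u x n) (halpern T lam u x (n + 1)), h3] at h6
  linarith

/-! ### Resolvents and their distance to the anchor u. -/

theorem exists_resolvent [CompleteSpace X] (hClosed : IsClosed C) (hConv : IsConvex C)
    (hTC : Set.MapsTo T C C) (hT : ∀ y ∈ C, ∀ z ∈ C, dist (T y) (T z) ≤ dist y z)
    (hu : u ∈ C) {t : ℝ} (ht : t ∈ Set.Ioc (0 : ℝ) 1) :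
    ∃ z ∈ C, comb u (T z) (1 - t) = z := by
  have ht' := one_sub_mem_Icc (Set.Ioc_subset_Icc_self ht)
  have hmaps : Set.MapsTo (fun y => comb u (T y) (1 - t)) C C :=
    fun y hy => hConv u hu _ (hTC hy) _ ht'
  have hcontr : ContractingWith ⟨1 - t, ht'.1⟩ (hmaps.restrict _ C C) := by
    refine ⟨?_, LipschitzWith.of_dist_le_mul fun y z => ?_⟩
    · exact NNReal.coe_lt_coe.1 (show 1 - t < 1 by linarith [ht.1])
    · exact (dist_comb_comb_same_left_le u (T y) (T z) ht').trans
        (mul_le_mul_of_nonneg_left (hT _ y.2 _ z.2) ht'.1)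
  obtain ⟨z, hz, hfix, -⟩ := hcontr.exists_fixedPoint' hClosed.isComplete hmaps hu
    (edist_ne_top _ _)
  exact ⟨z, hz, hfix⟩

theorem resolvent_dist_sq_le (hT : ∀ y ∈ C, ∀ z ∈ C, dist (T y) (T z) ≤ dist y z)
    {z w : X} (hz : z ∈ C) (hw : w ∈ C) {s t : ℝ} (ht0 : 0 < t) (hts : t < s) (hs : s ≤ 1)
    (hzs : comb u (T z) (1 - s) = z) (hwt : comb u (T w) (1 - t) = w) :
    dist z w ^ 2 ≤ dist u w ^ 2 - dist u z ^ 2 := by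
  have hs' : 1 - s ∈ Set.Icc (0 : ℝ) 1 := ⟨by linarith, by linarith⟩
  have ht' : 1 - t ∈ Set.Icc (0 : ℝ) 1 := ⟨by linarith, by linarith⟩
  have h1 := dist_comb_sq_le w u (T z) hs'
  have h2 := dist_comb_sq_le (T z) u (T w) ht'
  have e1 := dist_left_comb u (T z) hs'
  have e2 := dist_left_comb u (T w) ht'
  rw [hzs] at h1 e1
  rw [hwt] at h2 e2
  rw [dist_comm w z, dist_comm w u, dist_comm w (T z), e2] at h1
  rw [dist_comm (T z) u] at h2
  have h3 : dist (T z) (T w) ^ 2 ≤ dist z w ^ 2 :=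
    pow_le_pow_left₀ dist_nonneg (hT z hz w hw) 2
  rw [e1, e2]
  set D := dist z w ^ 2
  set a := dist u (T z)
  set b := dist u (T w)
  -- In these terms d(u, w)² = (1 - t) P and d(u, z)² = (1 - s) Q.
  set P := (1 - t) * b ^ 2 with hP
  set Q := (1 - s) * a ^ 2 with hQ
  have hQ0 : 0 ≤ Q := mul_nonneg hs'.1 (sq_nonneg _)
  have hD0 : 0 ≤ D := sq_nonneg _
  have hst : 0 < s + t - s * t := by nlinarith
  have h4 : (s + t - s * t) * D ≤ (s - t) * (P - Q) := by
    have h5 := mul_le_mul_of_nonneg_left h2 hs'.1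
    have h6 := mul_le_mul_of_nonneg_left h3 (mul_nonneg hs'.1 ht'.1)
    rw [hP, hQ]
    linarith
  have hPQ : 0 ≤ P - Q := by
    by_contra! hneg
    have := mul_pos_of_neg_of_neg hneg (by linarith : t - s < 0)
    nlinarith [mul_nonneg hst.le hD0]
  -- The right side exceeds the left by exactly the sum of the nonnegative terms in `c1` and `c2`.
  have hfin : (s - t) * (P - Q) ≤ (s + t - s * t) * ((1 - t) * P - (1 - s) * Q) := by
    have c1 : 0 ≤ (1 - s) * (t * (2 - t)) * (P - Q) :=
      mul_nonneg (mul_nonneg hs'.1 (mul_nonneg ht0.le (by linarith))) hPQ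
    have c2 : 0 ≤ (s - t) * (s + t - s * t) * Q :=
      mul_nonneg (mul_nonneg (by linarith) hst.le) hQ0
    linarith
  have h7 := le_of_mul_le_mul_left (h4.trans hfin) hst
  rw [hP, hQ] at h7
  linarith

/-- The resolvent at `t` is almost at least as close to `u` as an almost fixed point `y`. -/
theorem dist_resolvent_sq_le (hTC : Set.MapsTo T C C)
    (hT : ∀ y ∈ C, ∀ z ∈ C, dist (T y) (T z) ≤ dist y z)
    (hM : ∀ y ∈ C, ∀ z ∈ C, dist y z ≤ M) {y z : X} (hy : y ∈ C) (hz : z ∈ C) {t : ℝ}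
    (ht0 : 0 < t) (ht1 : t ≤ 1) (hzt : comb u (T z) (1 - t) = z) :
    t * dist u z ^ 2 ≤ t * dist u y ^ 2 + 2 * M * dist y (T y) := by
  have ht' : 1 - t ∈ Set.Icc (0 : ℝ) 1 := ⟨by linarith, by linarith⟩
  have h1 := dist_comb_sq_le y u (T z) ht'
  have e1 := dist_left_comb u (T z) ht'
  rw [hzt] at h1 e1
  rw [dist_comm y u] at h1
  have h2 : dist y (T z) ≤ dist y z + dist y (T y) := by
    linarith [dist_triangle y (T y) (T z), hT y hy z hz]
  have h3 : dist y (T z) ^ 2 ≤ dist y z ^ 2 + 2 * M * dist y (T y) := by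
    have := hM y hy _ (hTC hz)
    have := hM y hy z hz
    have d1 : 0 ≤ dist y (T z) := dist_nonneg
    have d2 : 0 ≤ dist y z := dist_nonneg
    have d3 : 0 ≤ dist y (T y) := dist_nonneg
    nlinarith [mul_le_mul_of_nonneg_left h2 (add_nonneg d1 d2)]
  have h4 : 0 ≤ 2 * M * dist y (T y) := by positivity
  have h5 := mul_le_mul_of_nonneg_left h3 ht'.1
  have h6 : 0 ≤ t * t * (1 - t) * dist u (T z) ^ 2 := by
    have := ht'.1
    positivity
  rw [e1]
  nlinarith [mul_nonneg ht0.le h4, mul_nonneg ht0.le (sq_nonneg (dist y z))]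

/-- Since z is a combination of u and T z, replacing d(T x_n, z)² by d(x_n, z)² costs only t M². The
negative CN term supplies the bracket that later becomes small. -/
theorem dist_halpern_resolvent_sq_le (hConv : IsConvex C) (hTC : Set.MapsTo T C C)
    (hT : ∀ y ∈ C, ∀ z ∈ C, dist (T y) (T z) ≤ dist y z)
    (hM : ∀ y ∈ C, ∀ z ∈ C, dist y z ≤ M)
    (hlam : ∀ n : ℕ, 1 ≤ n → lam n ∈ Set.Icc (0 : ℝ) 1) (hu : u ∈ C) (hx : x ∈ C)
    {z : X} (hz : z ∈ C) {t : ℝ} (ht0 : 0 < t) (ht1 : t ≤ 1)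
    (hzt : comb u (T z) (1 - t) = z) (n : ℕ) :
    dist (halpern T lam u x (n + 1)) z ^ 2 ≤
      (1 - lam (n + 1)) * dist (halpern T lam u x n) z ^ 2 +
      lam (n + 1) *
        (dist u z ^ 2 - (1 - lam (n + 1)) * dist u (T (halpern T lam u x n)) ^ 2) +
      t * M ^ 2 := by
  have hl := hlam (n + 1) (by omega)
  have hmem := halpern_mem hConv hTC hlam hu hx n
  have h1 : dist z (halpern T lam u x (n + 1)) ^ 2 ≤ _ :=
    dist_comb_sq_le z u (T (halpern T lam u x n)) (one_sub_mem_Icc hl)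
  have ht' : 1 - t ∈ Set.Icc (0 : ℝ) 1 := ⟨by linarith, by linarith⟩
  set y := halpern T lam u x n
  have h2 := dist_comb_sq_le (T y) u (T z) ht'
  rw [hzt] at h2
  have h3 : dist (T y) (T z) ^ 2 ≤ dist y z ^ 2 :=
    pow_le_pow_left₀ dist_nonneg (hT y hmem z hz) 2
  have h4 : dist (T y) u ^ 2 ≤ (M : ℝ) ^ 2 :=
    pow_le_pow_left₀ dist_nonneg (hM _ (hTC hmem) u hu) 2
  have h5 : dist (T y) z ^ 2 ≤ dist y z ^ 2 + t * M ^ 2 := by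
    have a1 := mul_le_mul_of_nonneg_left h3 ht'.1
    have a2 := mul_le_mul_of_nonneg_left h4 ht0.le
    have a3 := mul_nonneg (mul_nonneg ht'.1 ht0.le) (sq_nonneg (dist u (T z)))
    have a4 := mul_nonneg ht0.le (sq_nonneg (dist y z))
    linarith
  rw [dist_comm z (halpern T lam u x (n + 1)), dist_comm z u, dist_comm z (T y)] at h1
  have h6 := mul_le_mul_of_nonneg_left h5 (one_sub_mem_Icc hl).1
  have h7 := mul_nonneg hl.1 (mul_nonneg ht0.le (sq_nonneg (M : ℝ)))
  linarith

theorem one_le_chiStar (k : ℕ) (δ : ℝ) : 1 ≤ chiStar M θ α β k δ := by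
  unfold chiStar PhiTilde
  omega

/-- `PTilde` is `Phi` times a factor at least 1, rounded up; only this much of `chiStar` is needed
for almost fixed points. -/
theorem Phi_le_chiStar (hM1 : 1 ≤ M) (k : ℕ) {δ : ℝ} (hδ : 0 < δ) (hδ1 : δ ≤ 1) :
    Phi M θ α β (δ / (24 * M * (k + 1))) ≤ chiStar M θ α β k δ := by
  have hM1' : (1 : ℝ) ≤ M := by exact_mod_cast hM1
  refine le_trans ?_ (Nat.le_add_left _ _)
  unfold PTilde
  rw [show δ / 2 / (12 * (M : ℝ) * ((k : ℝ) + 1)) = δ / (24 * M * (k + 1)) by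
    field_simp; norm_num]
  have h : (1 : ℝ) ≤ 12 * (M : ℝ) ^ 2 * ((k : ℝ) + 1) / (δ / 2) := by
    rw [le_div_iff₀ (by positivity)]
    have : (1 : ℝ) ≤ (M : ℝ) ^ 2 * (k + 1) :=
      one_le_mul_of_one_le_of_one_le (one_le_pow₀ hM1') (by linarith [k.cast_nonneg (α := ℝ)])
    linarith
  exact_mod_cast (le_mul_of_one_le_left
    (Phi M θ α β (δ / (24 * M * (k + 1)))).cast_nonneg h).trans (Nat.le_ceil _)

/-- Beyond `chiStar`, the resolvent `z` at `1 / (k + 1)` is almost at least as close to `u` as the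
points `T xₙ`. -/
theorem dist_resolvent_sq_sub_le (hConv : IsConvex C) (hTC : Set.MapsTo T C C)
    (hT : ∀ y ∈ C, ∀ z ∈ C, dist (T y) (T z) ≤ dist y z)
    (hM1 : 1 ≤ M) (hM : ∀ y ∈ C, ∀ z ∈ C, dist y z ≤ M)
    (hlam : ∀ n : ℕ, 1 ≤ n → lam n ∈ Set.Icc (0 : ℝ) 1) (hu : u ∈ C) (hx : x ∈ C)
    (hα : IsRateOfConvergence α lam 0)
    (hβ : IsCauchyModulus β (fun n : ℕ => ∑ i ∈ Finset.Icc 1 n, |lam (i + 1) - lam i|))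
    (hθ : IsRateOfDivergence θ (fun n : ℕ => lam (n + 1)))
    {z : X} (hz : z ∈ C) {k : ℕ} (hzk : comb u (T z) (1 - 1 / ((k : ℝ) + 1)) = z)
    {δ : ℝ} (hδ : 0 < δ) (hδ1 : δ ≤ 1) {n : ℕ} (hn : chiStar M θ α β k δ ≤ n) :
    dist u z ^ 2 - (1 - lam (n + 1)) * dist u (T (halpern T lam u x n)) ^ 2 ≤ δ / 2 := by
  have hM1' : (1 : ℝ) ≤ M := by exact_mod_cast hM1
  have hk : (1 : ℝ) ≤ (k : ℝ) + 1 := by linarith [k.cast_nonneg (α := ℝ)]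
  -- Clearing t = 1/(k+1) in `dist_resolvent_sq_le` multiplies the error 2Mη by k + 1, giving δ/12.
  set η := δ / (24 * M * ((k : ℝ) + 1)) with hη
  have hη0 : 0 < η := by positivity
  obtain ⟨h1, h2⟩ := dist_halpern_map_le_of_Phi_le hConv hTC hT hM1 hM hlam hu hx hα hβ hθ hη0
    ((Phi_le_chiStar hM1 k hδ hδ1).trans hn)
  have hmem := halpern_mem hConv hTC hlam hu hx n
  have h3 := dist_resolvent_sq_le (u := u) hTC hT hM hmem hz (t := 1 / ((k : ℝ) + 1))
    (by positivity) (by rw [div_le_one (by positivity)]; exact hk) hzk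
  set y := halpern T lam u x n
  have h4 : dist u z ^ 2 ≤ dist u y ^ 2 + δ / 12 := by
    have e : (k + 1 : ℝ) * (2 * M * η) = δ / 12 := by rw [hη]; field_simp; norm_num
    have h5 := mul_le_mul_of_nonneg_left h3 (by positivity : (0 : ℝ) ≤ k + 1)
    have h6 : (k + 1 : ℝ) * (2 * M * dist y (T y)) ≤ δ / 12 := by rw [← e]; gcongr
    rw [mul_add, ← mul_assoc, ← mul_assoc, mul_one_div_cancel (by positivity), one_mul,
      one_mul] at h5
    linarith
  have hMη : M * η ≤ δ / 24 := by
    rw [show M * η = δ / 24 / (k + 1) by rw [hη]; field_simp]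
    exact div_le_self (by positivity) hk
  have d0 : 0 ≤ dist u (T y) := dist_nonneg
  have dM := hM u hu _ (hTC hmem)
  have h7 : dist u y ^ 2 ≤ dist u (T y) ^ 2 + 2 * M * η := by
    have a1 := dist_triangle_right u y (T y)
    have a2 := hM u hu y hmem
    have a3 : 0 ≤ dist u y := dist_nonneg
    nlinarith
  have h8 : lam (n + 1) * dist u (T y) ^ 2 ≤ η / (4 * M) * M ^ 2 :=
    mul_le_mul h1 (pow_le_pow_left₀ d0 dM 2) (sq_nonneg _) (by positivity)
  rw [show η / (4 * M) * M ^ 2 = M * η / 4 by field_simp] at h8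
  linarith

/-! ### The metastability bound. -/

theorem metastable_halpern [CompleteSpace X] (hClosed : IsClosed C) (hConv : IsConvex C)
    (hTC : Set.MapsTo T C C) (hT : ∀ y ∈ C, ∀ z ∈ C, dist (T y) (T z) ≤ dist y z)
    (hM1 : 1 ≤ M) (hM : ∀ y ∈ C, ∀ z ∈ C, dist y z ≤ M)
    (hlam : ∀ n : ℕ, 1 ≤ n → lam n ∈ Set.Icc (0 : ℝ) 1) (hu : u ∈ C) (hx : x ∈ C)
    (hα : IsRateOfConvergence α lam 0)
    (hβ : IsCauchyModulus β (fun n : ℕ => ∑ i ∈ Finset.Icc 1 n, |lam (i + 1) - lam i|))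
    (hθ : IsRateOfDivergence θ (fun n : ℕ => lam (n + 1)))
    {ε : ℝ} (hε : 0 < ε) (hε2 : ε < 2) (g : ℕ → ℕ) :
    ∃ N : ℕ, N ≤ SigmaRate ε g M θ α β ∧
      ∀ m ∈ Set.Icc N (N + g N), ∀ n ∈ Set.Icc N (N + g N),
        dist (halpern T lam u x n) (halpern T lam u x m) ≤ ε := by
  have hM1' : (1 : ℝ) ≤ M := by exact_mod_cast hM1
  have hmem := halpern_mem hConv hTC hlam hu hx
  have hεsq : ε ^ 2 < 4 := by nlinarith
  have ht : ∀ k : ℕ, 1 / ((k : ℝ) + 1) ∈ Set.Ioc (0 : ℝ) 1 := fun k =>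
    ⟨by positivity, by rw [div_le_one (by positivity)]; linarith [k.cast_nonneg (α := ℝ)]⟩
  choose z hz hzk using fun k => exists_resolvent hClosed hConv hTC hT hu (ht k)
  have hmono : Monotone fun k => dist u (z k) ^ 2 := by
    refine monotone_nat_of_le_succ fun k => ?_
    have := resolvent_dist_sq_le (u := u) hT (hz k) (hz (k + 1)) (ht (k + 1)).1
      (by push_cast; gcongr; linarith) (ht k).2 (hzk k) (hzk (k + 1))
    linarith [sq_nonneg (dist (z k) (z (k + 1)))]
  have he0 : 0 < eps0 ε M := by unfold eps0; positivity
  obtain ⟨i, hi, hK⟩ := exists_iterate_sub_le (δ := eps0 ε M ^ 2)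
    (a := fun k => dist u (z k) ^ 2) (sq_nonneg _)
    (B := (M : ℝ) ^ 2) (fun n => pow_le_pow_left₀ dist_nonneg (hM u hu _ (hz n)) 2)
    (p := ⌈(M : ℝ) ^ 2 / eps0 ε M ^ 2⌉₊) (Nat.ceil_pos.2 (by positivity))
    (by rw [← div_le_iff₀ (by positivity)]; exact Nat.le_ceil _) (fStarTilde ε g M θ α β)
  set c := ⌈1 / eps0 ε M⌉₊
  set K₀ := (fStarTilde ε g M θ α β)^[i] 0
  -- About the shift c, the estimates use only that K ≥ K₀ and that K lies in the index range of
  -- `Gam`.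
  set K := K₀ + c
  set J := max ⌈(M : ℝ) ^ 2 / DeltaStar g M θ α β K (ε ^ 2 / 4)⌉₊ K
  have hJ : fStarTilde ε g M θ α β K₀ = J := by
    have : K ≤ J := le_max_right _ _
    change K₀ + (J - K + c) = J
    omega
  simp only [hJ] at hK
  set χ := chiStar M θ α β K (ε ^ 2 / 12) with hχ
  have hχ1 : 1 ≤ χ := one_le_chiStar K _
  have hthird : ε ^ 2 / 4 / 3 = ε ^ 2 / 12 := by ring
  set r := ⌈Real.log (12 * (M : ℝ) ^ 2 / ε ^ 2)⌉₊ with hr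
  have hr1 : 1 ≤ r := by
    refine Nat.ceil_pos.2 (Real.log_pos ?_)
    rw [lt_div_iff₀ (by positivity)]
    nlinarith
  have hN : Theta M θ α β K (ε ^ 2 / 4) = θ (χ - 1 + r) + 1 := by
    unfold Theta
    rw [hthird, ← hχ, show 3 * (M : ℝ) ^ 2 / (ε ^ 2 / 4) = 12 * (M : ℝ) ^ 2 / ε ^ 2 by
      field_simp; norm_num]
  set N := Theta M θ α β K (ε ^ 2 / 4) with hNdef
  have hχN : χ < N := by
    have := hθ.le_apply hlam (n := χ - 1 + r) (by omega)
    omega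
  have hNSigma : N ≤ SigmaRate ε g M θ α β := by
    have hKmem : K ∈ Finset.Icc c
        ((fStarTilde ε g M θ α β)^[⌈(M : ℝ) ^ 2 / eps0 ε M ^ 2⌉₊] 0 + c) := by
      refine Finset.mem_Icc.2 ⟨Nat.le_add_left _ _, Nat.add_le_add_right ?_ _⟩
      exact Function.monotone_iterate_of_id_le (f := fStarTilde ε g M θ α β)
        (fun k => Nat.le_add_right _ _) hi.le 0
    have hχΓ : χ ≤ Gam ε g M θ α β :=
      Finset.le_sup (f := fun k => chiStar M θ α β k (ε ^ 2 / 12)) hKmem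
    rw [hN]
    refine Nat.add_le_add_right (Finset.le_sup (f := θ) (Finset.mem_Icc.2 ⟨by omega, ?_⟩)) 1
    exact Nat.add_le_add_right (Nat.sub_le_sub_right hχΓ 1) _
  have heps : eps0 ε M ^ 2 ≤ ε ^ 2 / 24 := by
    have h1 : eps0 ε M ≤ ε ^ 2 / 24 := by
      unfold eps0
      gcongr
      nlinarith
    nlinarith
  -- The threshold χ belongs to K, although J was chosen depending on it: passing from z_K to z_J
  -- costs at most ε₀² ≤ ε²/24 by `hK` and monotonicity.
  have hclose : ∀ n, χ ≤ n → dist u (z J) ^ 2 -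
      (1 - lam (n + 1)) * dist u (T (halpern T lam u x n)) ^ 2 ≤ ε ^ 2 / 12 := by
    intro n hn
    have h1 := dist_resolvent_sq_sub_le hConv hTC hT hM1 hM hlam hu hx hα hβ hθ (hz K) (hzk K)
      (δ := ε ^ 2 / 12) (by positivity) (by linarith) hn
    have h2 : dist u (z K₀) ^ 2 ≤ dist u (z K) ^ 2 := hmono (Nat.le_add_right _ _)
    linarith
  have hdist : ∀ n ∈ Set.Icc N (N + g N), dist (halpern T lam u x n) (z J) ≤ ε / 2 := by
    rintro n ⟨hn1, hn2⟩
    -- The first step from χ uses λ_{χ+1} = λ_{m+2}, hence the χ - 1 inside `Theta`.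
    obtain ⟨m, hm⟩ : ∃ m, χ = m + 1 := ⟨χ - 1, by omega⟩
    obtain ⟨j, rfl⟩ : ∃ j, n = χ + j := ⟨n - χ, by omega⟩
    have hrec := le_of_recursive_inequality (A := (M : ℝ) ^ 2) (b := ε ^ 2 / 12)
      (a := fun j => dist (halpern T lam u x (χ + j)) (z J) ^ 2)
      (l := fun j => lam (χ + j + 1)) (e := fun _ => 1 / ((J : ℝ) + 1) * M ^ 2)
      (by positivity) (fun j => hlam _ (by omega)) (fun j => by positivity)
      (by
        have := pow_le_pow_left₀ dist_nonneg (hM _ (hmem (χ + 0)) _ (hz J)) 2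
        have : 0 ≤ ε ^ 2 / 12 := by positivity
        linarith)
      (fun j => by
        have h1 := dist_halpern_resolvent_sq_le hConv hTC hT hM hlam hu hx (hz J)
          (ht J).1 (ht J).2 (hzk J) (χ + j)
        have h2 := mul_le_mul_of_nonneg_left (hclose (χ + j) (by omega))
          (hlam (χ + j + 1) (by omega)).1
        exact h1.trans (by linarith)) j
    have hexp : (M : ℝ) ^ 2 * Real.exp (-∑ i ∈ Finset.range j, lam (χ + i + 1)) ≤
        ε ^ 2 / 12 := by
      have h1 := (Nat.le_ceil _).trans (hθ.le_sum hlam (m := m) (r := r) (i := j) (by omega)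
        (by rw [show m = χ - 1 by omega]; omega))
      have h2 : ∑ i ∈ Finset.range j, lam (χ + i + 1) =
          ∑ i ∈ Finset.range j, lam (m + i + 2) :=
        Finset.sum_congr rfl fun i _ => by congr 1; omega
      have h3 : Real.exp (-∑ i ∈ Finset.range j, lam (χ + i + 1)) ≤
          (12 * (M : ℝ) ^ 2 / ε ^ 2)⁻¹ := by
        rw [← Real.exp_log (by positivity : (0 : ℝ) < 12 * (M : ℝ) ^ 2 / ε ^ 2),
          ← Real.exp_neg, h2]
        exact Real.exp_le_exp.2 (by linarith)
      calc _ ≤ (M : ℝ) ^ 2 * (12 * (M : ℝ) ^ 2 / ε ^ 2)⁻¹ := by gcongr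
        _ = ε ^ 2 / 12 := by field_simp
    -- G is the distance from χ to the end of the window, and `DeltaStar` allots each of at most G
    -- steps the error ε²/(12 G).
    have herr : (j : ℝ) * (1 / ((J : ℝ) + 1) * M ^ 2) ≤ ε ^ 2 / 12 := by
      set G := gShift g M θ α β (ε ^ 2 / 4) K (N - χ) with hG
      have hG' : G = N - χ + g N := by
        rw [hG, gShift, hthird, ← hχ, Nat.sub_add_cancel hχN.le]
      have hΔ : DeltaStar g M θ α β K (ε ^ 2 / 4) = ε ^ 2 / 4 / (3 * (G : ℝ)) := by
        rw [DeltaStar, hthird]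
      have hGpos : (0 : ℝ) < G := by
        have : 0 < G := by omega
        exact_mod_cast this
      have hjG : (j : ℝ) ≤ G := by
        have : j ≤ G := by omega
        exact_mod_cast this
      have hJle : (M : ℝ) ^ 2 / DeltaStar g M θ α β K (ε ^ 2 / 4) ≤ (J : ℝ) + 1 :=
        ((Nat.le_ceil _).trans (Nat.cast_le.2 (le_max_left _ _))).trans (by linarith)
      rw [div_le_iff₀ (by rw [hΔ]; positivity), ← div_le_iff₀' (by positivity), hΔ] at hJle
      calc (j : ℝ) * (1 / ((J : ℝ) + 1) * M ^ 2)
          ≤ G * (ε ^ 2 / 4 / (3 * (G : ℝ))) := by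
            rw [one_div_mul_eq_div]
            gcongr
        _ = ε ^ 2 / 12 := by field_simp; norm_num
    rw [Finset.sum_const, Finset.card_range, nsmul_eq_mul] at hrec
    -- Three contributions of ε²/12 add up to (ε/2)².
    refine le_of_sq_le_sq (hrec.trans ?_) (by positivity)
    linarith
  refine ⟨N, hNSigma, fun m hm n hn => ?_⟩
  linarith [dist_triangle_right (halpern T lam u x n) (halpern T lam u x m) (z J),
    hdist m hm, hdist n hn]

end Halpern

/-! ### Existence of rates -/

theorem exists_isRateOfConvergence {a : ℕ → ℝ} {l : ℝ}
    (h : Filter.Tendsto a Filter.atTop (nhds l)) : ∃ γ, IsRateOfConvergence γ a l := by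
  have : ∀ ε : ℝ, ∃ k : ℕ, 0 < ε → 1 ≤ k ∧ ∀ n : ℕ, k ≤ n → |a n - l| ≤ ε := by
    intro ε
    by_cases hε : 0 < ε
    · obtain ⟨k, hk⟩ := Metric.tendsto_atTop.1 h ε hε
      exact ⟨k + 1, fun _ => ⟨by omega, fun n hn => (hk n (by omega)).le⟩⟩
    · exact ⟨0, fun h => absurd h hε⟩
  choose γ hγ using this
  exact ⟨γ, hγ⟩

theorem exists_isCauchyModulus {a : ℕ → ℝ} (h : CauchySeq a) : ∃ γ, IsCauchyModulus γ a := by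
  have : ∀ ε : ℝ, ∃ k : ℕ, 0 < ε → 1 ≤ k ∧ ∀ n : ℕ, a (k + n) - a k ≤ ε := by
    intro ε
    by_cases hε : 0 < ε
    · obtain ⟨k, hk⟩ := Metric.cauchySeq_iff.1 h ε hε
      refine ⟨k + 1, fun _ => ⟨by omega, fun n => ?_⟩⟩
      exact (le_abs_self _).trans (hk (k + 1 + n) (by omega) (k + 1) (by omega)).le
    · exact ⟨0, fun h => absurd h hε⟩
  choose γ hγ using this
  exact ⟨γ, hγ⟩

theorem exists_isRateOfDivergence {a : ℕ → ℝ}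
    (h : Filter.Tendsto (fun N : ℕ => ∑ n ∈ Finset.Icc 1 N, a n) Filter.atTop Filter.atTop) :
    ∃ γ, IsRateOfDivergence γ a := by
  have : ∀ n : ℕ, ∃ k : ℕ, 1 ≤ n → 1 ≤ k ∧ (n : ℝ) ≤ ∑ i ∈ Finset.Icc 1 k, a i := by
    intro n
    obtain ⟨k, hk, hk'⟩ := ((h.eventually_ge_atTop (n : ℝ)).and
      (Filter.eventually_ge_atTop 1)).exists
    exact ⟨k, fun _ => ⟨hk', hk⟩⟩
  choose γ hγ using this
  exact ⟨γ, hγ⟩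

/-- A metastable sequence is Cauchy. -/
theorem cauchySeq_of_metastable {X : Type*} [PseudoMetricSpace X] {a : ℕ → X}
    (h : ∀ ε : ℝ, 0 < ε → ε < 2 → ∀ g : ℕ → ℕ, ∃ N : ℕ, ∀ m ∈ Set.Icc N (N + g N),
      ∀ n ∈ Set.Icc N (N + g N), dist (a n) (a m) ≤ ε) : CauchySeq a := by
  rw [Metric.cauchySeq_iff]
  by_contra! hcon
  obtain ⟨ε, hε, hcon⟩ := hcon
  choose p hp q hq hpq using hcon
  -- This g makes every window contain the pair of indices that violates the Cauchy condition.
  obtain ⟨N, hN⟩ := h (min (ε / 2) 1) (by positivity) ((min_le_right _ _).trans_lt one_lt_two)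
    (fun N => max (p N) (q N))
  have h1 := hN (q N) ⟨hq N, (le_max_right _ _).trans (Nat.le_add_left _ _)⟩ (p N)
    ⟨hp N, (le_max_left _ _).trans (Nat.le_add_left _ _)⟩
  linarith [hpq N, min_le_left (ε / 2) 1]

end HalpernCAT0

theorem theorem4p2 {X : Type*} [MetricSpace X] [CompleteSpace X] [HalpernCAT0.CAT0Space X]
    (C : Set X) (hClosed : IsClosed C) (hBdd : Bornology.IsBounded C)
    (hConv : HalpernCAT0.IsConvex C)
    (T : X → X) (hTC : Set.MapsTo T C C) (hT : LipschitzOnWith 1 T C)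
    (lam : ℕ → ℝ) (hlam : ∀ n : ℕ, 1 ≤ n → lam n ∈ Set.Icc (0 : ℝ) 1)
    (hC1 : Filter.Tendsto lam Filter.atTop (nhds 0))
    (hC2 : Summable (fun n : ℕ => |lam (n + 2) - lam (n + 1)|))
    (hC3 : Filter.Tendsto (fun N : ℕ => ∑ n ∈ Finset.Icc 1 N, lam n) Filter.atTop Filter.atTop)
    (u x : X) (hu : u ∈ C) (hx : x ∈ C) :
    CauchySeq (HalpernCAT0.halpern T lam u x) ∧
    ∀ (α β : ℝ → ℕ) (θ : ℕ → ℕ) (M : ℕ),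
      HalpernCAT0.IsRateOfConvergence α lam 0 →
      HalpernCAT0.IsCauchyModulus β
        (fun n : ℕ => ∑ i ∈ Finset.Icc 1 n, |lam (i + 1) - lam i|) →
      HalpernCAT0.IsRateOfDivergence θ (fun n : ℕ => lam (n + 1)) →
      1 ≤ M → Metric.diam C ≤ (M : ℝ) →
      ∀ ε : ℝ, 0 < ε → ε < 2 → ∀ g : ℕ → ℕ,
        ∃ N : ℕ, N ≤ HalpernCAT0.SigmaRate ε g M θ α β ∧
          ∀ m ∈ Set.Icc N (N + g N), ∀ n ∈ Set.Icc N (N + g N),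
            dist (HalpernCAT0.halpern T lam u x n) (HalpernCAT0.halpern T lam u x m) ≤ ε := by
  have hT' : ∀ y ∈ C, ∀ z ∈ C, dist (T y) (T z) ≤ dist y z := fun y hy z hz => by
    simpa using hT.dist_le_mul y hy z hz
  refine ⟨?_, fun α β θ M hα hβ hθ hM1 hM ε hε hε2 g =>
    HalpernCAT0.metastable_halpern hClosed hConv hTC hT' hM1
      (fun y hy z hz => (Metric.dist_le_diam_of_mem hBdd hy hz).trans hM)
      hlam hu hx hα hβ hθ hε hε2 g⟩
  -- The Cauchy claim comes with no rates, so they are extracted from (C1)–(C3) by choice.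
  obtain ⟨α, hα⟩ := HalpernCAT0.exists_isRateOfConvergence hC1
  obtain ⟨β, hβ⟩ : ∃ β, HalpernCAT0.IsCauchyModulus β
      (fun n : ℕ => ∑ i ∈ Finset.Icc 1 n, |lam (i + 1) - lam i|) := by
    refine HalpernCAT0.exists_isCauchyModulus ?_
    simp only [HalpernCAT0.sum_Icc_one_eq_sum_range]
    exact hC2.hasSum.tendsto_sum_nat.cauchySeq
  obtain ⟨θ, hθ⟩ : ∃ θ, HalpernCAT0.IsRateOfDivergence θ (fun n : ℕ => lam (n + 1)) := by
    refine HalpernCAT0.exists_isRateOfDivergence ?_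
    have h := Filter.tendsto_atTop_add_const_right _ (-lam 1)
      (hC3.comp (Filter.tendsto_add_atTop_nat 1))
    refine h.congr fun N => ?_
    simp only [Function.comp_apply, HalpernCAT0.sum_Icc_one_eq_sum_range]
    rw [Finset.sum_range_succ']
    ring
  refine HalpernCAT0.cauchySeq_of_metastable fun ε hε hε2 g => ?_
  obtain ⟨M, hM⟩ := exists_nat_ge (Metric.diam C)
  obtain ⟨N, -, hN⟩ := HalpernCAT0.metastable_halpern (M := M + 1) hClosed hConv hTC hT'
    (Nat.le_add_left _ _)
    (fun y hy z hz => (Metric.dist_le_diam_of_mem hBdd hy hz).trans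
      (hM.trans (by push_cast; linarith)))
    hlam hu hx hα hβ hθ hε hε2 g
  exact ⟨N, hN⟩
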